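/- Let $E$ be a complex vector space of dimension $5$, and let $V=E^*\oplus E$ carry the non-degenerate quadratic form $Q(f,e)=f(e)$. Let $V$ act on the spin module $\Delta=\bigwedge E$ by $(f,e)\cdot s=f\lrcorner s+e\wedge s$, and let $\Delta^+=\bigwedge^0E\oplus\bigwedge^2E\oplus\bigwedge^4E$, so that $\mathbb P(\Delta^+)=\mathbb P^{15}$. The spinor variety $\mathbb S_5\subset\mathbb P^{15}$ is the set of the points $[s]\in\mathbb P(\Delta^+)$ for which there is a $5$-dimensional $Q$-isotropic subspace $W\subset V$ with $w\cdot s=0$ for all $w\in W$; it is the projective embedding, in $\mathbb P^{15}$, of one of the two components of the space of $5$-dimensional $Q$-isotropic subspaces of $V$. For a subset $S$ of a complex projective space, let $\mathrm{Sec}(S)$ be the Zariski closure of the union of the lines $\ell_{x,y}$ through two distinct points $x,y\in S$. For $z\in\mathrm{Sec}(S)\setminus S$, the entry locus of $S$ with respect to $z$ is the Zariski closure of $\{x\in S : z\in\ell_{x,y}\text{ for some }y\in S,\ y\neq x\}$. Proposition. Let $A\neq B$ be two distinct entry loci of $\mathbb S_5\subset\mathbb P^{15}$. Then either $A\cap B=\emptyset$,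 or $A\cap B$ is a $3$-dimensional linear subspace $\mathbb P^3$ of $\mathbb P^{15}$. -/

import Mathlib

noncomputable section

/-! ### Projective geometry over the complex numbers -/

section ProjectiveGeometry

variable {M : Type*} [AddCommGroup M] [Module ℂ M]

/-- The value at `x : M` of a polynomial expression `F` in the linear forms on `M`. Every polynomial
function on `M` is of this form. -/
def evalAt (F : MvPolynomial (Module.Dual ℂ M) ℂ) (x : M) : ℂ :=
  MvPolynomial.eval (fun φ : Module.Dual ℂ M => φ x) F

/-- The Zariski closure of a subset `A` of the projective space `ℙ(M)` of lines in `M`: the common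
zeros of all homogeneous polynomials that vanish on `A`. -/
def zariskiClosure (A : Set (Projectivization ℂ M)) : Set (Projectivization ℂ M) :=
  {p | ∀ (n : ℕ) (F : MvPolynomial (Module.Dual ℂ M) ℂ), F.IsHomogeneous n →
    (∀ a ∈ A, evalAt F a.rep = 0) → evalAt F p.rep = 0}

/-- The vanishing of a homogeneous polynomial at a point does not depend on the chosen
representative. -/
theorem evalAt_smul {n : ℕ} {F : MvPolynomial (Module.Dual ℂ M) ℂ} (hF : F.IsHomogeneous n)
    (c : ℂ) (x : M) : evalAt F (c • x) = c ^ n * evalAt F x := by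
  unfold evalAt
  rw [MvPolynomial.eval_eq, MvPolynomial.eval_eq, Finset.mul_sum]
  refine Finset.sum_congr rfl fun d hd => ?_
  have hdeg : ∑ i ∈ d.support, d i = n := by
    have := hF (MvPolynomial.mem_support_iff.mp hd)
    simpa [Finsupp.weight_apply, Finsupp.sum] using this
  simp only [map_smul, smul_eq_mul, mul_pow, Finset.prod_mul_distrib, Finset.prod_pow_eq_pow_sum,
    hdeg]
  ring

/-- The projective line through two points `x ≠ y` of `ℙ(M)`. -/
def lineThrough (x y : Projectivization ℂ M) : Set (Projectivization ℂ M) :=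
  {z | z.submodule ≤ x.submodule ⊔ y.submodule}

/-- The secant variety of `S ⊆ ℙ(M)`: the Zariski closure of the union of the lines through two
distinct points of `S`. -/
def secantVariety (S : Set (Projectivization ℂ M)) : Set (Projectivization ℂ M) :=
  zariskiClosure {z | ∃ x ∈ S, ∃ y ∈ S, y ≠ x ∧ z ∈ lineThrough x y}

/-- The entry locus of `S` with respect to the point `z`: the Zariski closure of the set of those
`x ∈ S` for which `z` lies on the line through `x` and another point of `S`. -/
def entryLocus (S : Set (Projectivization ℂ M)) (z : Projectivization ℂ M) :
    Set (Projectivization ℂ M) :=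
  zariskiClosure {x | x ∈ S ∧ ∃ y ∈ S, y ≠ x ∧ z ∈ lineThrough x y}

/-- `A` is an entry locus of `S`, i.e. the entry locus with respect to some point of the secant
variety outside `S`. -/
def IsEntryLocus (S A : Set (Projectivization ℂ M)) : Prop :=
  ∃ z ∈ secantVariety S \ S, A = entryLocus S z

/-- `A` is a linearly embedded projective space of dimension `k` in `ℙ(M)`. -/
def IsLinearSubspace (k : ℕ) (A : Set (Projectivization ℂ M)) : Prop :=
  ∃ L : Submodule ℂ M, Module.finrank ℂ L = k + 1 ∧
    A = {p : Projectivization ℂ M | p.submodule ≤ L}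

end ProjectiveGeometry

/-! ### The spinor variety -/

section Spinor

variable (E : Type*) [AddCommGroup E] [Module ℂ E]

/-- The action of `V = E* ⊕ E` on the spin module `Δ = ⋀ E`: a vector `(f, e)` acts as contraction
with `f` plus exterior multiplication by `e`. -/
def cliffordAction : (Module.Dual ℂ E × E) →ₗ[ℂ] Module.End ℂ (ExteriorAlgebra ℂ E) :=
  LinearMap.coprod CliffordAlgebra.contractLeft
    ((LinearMap.mul ℂ (ExteriorAlgebra ℂ E)).comp (ExteriorAlgebra.ι ℂ))

theorem cliffordAction_apply (v : Module.Dual ℂ E × E) (s : ExteriorAlgebra ℂ E) :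
    cliffordAction E v s = CliffordAlgebra.contractLeft v.1 s + ExteriorAlgebra.ι ℂ v.2 * s := rfl

/-- The Clifford relation `v · (v · s) = Q(v) s` for the quadratic form `Q(f, e) = f(e)` on
`E* ⊕ E`. -/
theorem cliffordAction_sq (v : Module.Dual ℂ E × E) (s : ExteriorAlgebra ℂ E) :
    cliffordAction E v (cliffordAction E v s) = QuadraticForm.dualProd ℂ E v • s := by
  simp only [cliffordAction_apply, map_add, CliffordAlgebra.contractLeft_contractLeft]
  rw [show ExteriorAlgebra.ι ℂ v.2 * (ExteriorAlgebra.ι ℂ v.2 * s) = 0 by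
      rw [← mul_assoc, ExteriorAlgebra.ι_sq_zero, zero_mul]]
  erw [CliffordAlgebra.contractLeft_ι_mul]
  simp [QuadraticForm.dualProd]

/-- The (even) half-spin module `Δ⁺ = ⋀⁰ E ⊕ ⋀² E ⊕ ⋀⁴ E ⊕ ⋯`, of dimension `2 ^ (m - 1)` for
`dim E = m`. -/
abbrev halfSpin : Submodule ℂ (ExteriorAlgebra ℂ E) :=
  CliffordAlgebra.evenOdd (0 : QuadraticForm ℂ E) 0

/-- `W` is an `m`-dimensional isotropic subspace of the `2m`-dimensional quadratic space
`(E* ⊕ E, Q)`, where `m = dim E` and `Q(f, e) = f(e)`. -/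
def IsMaxIsotropic (W : Submodule ℂ (Module.Dual ℂ E × E)) : Prop :=
  Module.finrank ℂ W = Module.finrank ℂ E ∧ ∀ w ∈ W, QuadraticForm.dualProd ℂ E w = 0

/-- The spinor variety `𝕊_m ⊆ ℙ(Δ⁺)`, `m = dim E`, consisting of the classes of even pure spinors.
For every `m`-dimensional isotropic `W ⊆ E* ⊕ E` the spinors annihilated by `W` form a line in
`Δ = Δ⁺ ⊕ Δ⁻` which lies in `Δ⁺` or in `Δ⁻`; the `W` for which it lies in `Δ⁺` form one of the two
components of the space of `m`-dimensional isotropic subspaces, and sending `W` to this line is the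
projective embedding of that component. -/
def spinorVariety : Set (Projectivization ℂ (halfSpin E)) :=
  {p | ∃ W : Submodule ℂ (Module.Dual ℂ E × E), IsMaxIsotropic E W ∧
    ∀ w ∈ W, cliffordAction E w (p.rep : ExteriorAlgebra ℂ E) = 0}

end Spinor

end

open Module

/-- A `32`-dimensional `ℤ/2`-graded module over the Clifford algebra of a `10`-dimensional
non-degenerate quadratic space with polar form `b`. -/
structure SpinModule (V Δ : Type*) [AddCommGroup V] [Module ℂ V] [AddCommGroup Δ] [Module ℂ Δ] where
  b : LinearMap.BilinForm ℂ V
  act : V →ₗ[ℂ] Module.End ℂ Δ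
  par : ZMod 2 → Submodule ℂ Δ
  symm : ∀ u w, b u w = b w u
  nondeg : b.Nondegenerate
  rel : ∀ u w s, act u (act w s) + act w (act u s) = b u w • s
  act_mem : ∀ i v s, s ∈ par i → act v s ∈ par (i + 1)
  isCompl : IsCompl (par 0) (par 1)
  finrank_V : finrank ℂ V = 10
  finrank_Δ : finrank ℂ Δ = 32

theorem Submodule.exists_le_finrank_eq {V : Type*} [AddCommGroup V] [Module ℂ V]
    (W : Submodule ℂ V) {k : ℕ} (hk : k ≤ finrank ℂ W) :
    ∃ N ≤ W, finrank ℂ N = k := by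
  obtain ⟨f, hf⟩ := exists_linearIndependent_of_le_finrank hk
  refine ⟨Submodule.map W.subtype (Submodule.span ℂ (Set.range f)), ?_, ?_⟩
  · exact Submodule.map_subtype_le _ _
  · rw [Submodule.finrank_map_subtype_eq, finrank_span_eq_card hf, Fintype.card_fin]

namespace SpinModule

variable {V Δ : Type*} [AddCommGroup V] [Module ℂ V] [AddCommGroup Δ] [Module ℂ Δ]
  (D : SpinModule V Δ)

include D in
theorem finite_V : FiniteDimensional ℂ V :=
  FiniteDimensional.of_finrank_pos (by rw [D.finrank_V]; norm_num)

include D in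
theorem finite_Δ : FiniteDimensional ℂ Δ :=
  FiniteDimensional.of_finrank_pos (by rw [D.finrank_Δ]; norm_num)

/-- The form `b` vanishes identically on `N`. -/
def Isotropic (N : Submodule ℂ V) : Prop := ∀ u ∈ N, ∀ w ∈ N, D.b u w = 0

theorem Isotropic.mono {D : SpinModule V Δ} {N N' : Submodule ℂ V} (h : D.Isotropic N)
    (hN : N' ≤ N) : D.Isotropic N' := fun u hu w hw => h u (hN hu) w (hN hw)

/-- The spinors of parity `i` annihilated by `N`. -/
def killed (N : Submodule ℂ V) (i : ZMod 2) : Submodule ℂ Δ :=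
  D.par i ⊓ ⨅ v ∈ N, LinearMap.ker (D.act v)

theorem mem_killed {N : Submodule ℂ V} {i : ZMod 2} {s : Δ} :
    s ∈ D.killed N i ↔ s ∈ D.par i ∧ ∀ v ∈ N, D.act v s = 0 := by
  simp [killed]

/-- The annihilator of a spinor. -/
def ann (s : Δ) : Submodule ℂ V := LinearMap.ker (D.act.flip s)

theorem mem_ann {s : Δ} {v : V} : v ∈ D.ann s ↔ D.act v s = 0 := by
  simp [ann]

theorem act_act_self (v : V) (s : Δ) : D.act v (D.act v s) = (D.b v v / 2) • s := by
  have h := D.rel v v s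
  have h2 : (2 : ℂ) • D.act v (D.act v s) = D.b v v • s := by rw [two_smul, h]
  rw [div_eq_inv_mul, mul_smul, ← h2, smul_smul, inv_mul_cancel₀ two_ne_zero, one_smul]

theorem act_comm_of_ortho {u w : V} (h : D.b u w = 0) (s : Δ) :
    D.act u (D.act w s) = - D.act w (D.act u s) := by
  have := D.rel u w s
  rw [h, zero_smul] at this
  exact eq_neg_of_add_eq_zero_left this

theorem isotropic_ann {s : Δ} (hs : s ≠ 0) : D.Isotropic (D.ann s) := by
  intro u hu w hw
  have := D.rel u w s
  rw [D.mem_ann.1 hu, D.mem_ann.1 hw] at this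
  simpa [hs] using this.symm

theorem isotropic_of_self {N : Submodule ℂ V} (h : ∀ v ∈ N, D.b v v = 0) : D.Isotropic N := by
  intro u hu w hw
  have h1 := h _ (N.add_mem hu hw)
  simp only [map_add, LinearMap.add_apply, h u hu, h w hw, D.symm w u] at h1
  linear_combination h1 / 2

theorem mem_ortho {N : Submodule ℂ V} {m : V} :
    m ∈ D.b.orthogonal N ↔ ∀ n ∈ N, D.b n m = 0 := by
  rw [LinearMap.BilinForm.mem_orthogonal_iff]

theorem finrank_ortho (N : Submodule ℂ V) :
    finrank ℂ (D.b.orthogonal N) = 10 - finrank ℂ N := by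
  have := D.finite_V
  rw [LinearMap.BilinForm.finrank_orthogonal D.nondeg, D.finrank_V]

theorem Isotropic.finrank_le {D : SpinModule V Δ} {N : Submodule ℂ V} (h : D.Isotropic N) :
    finrank ℂ N ≤ 5 := by
  have := D.finite_V
  have h1 : N ≤ D.b.orthogonal N := fun x hx => D.mem_ortho.2 fun n hn => h n hn x hx
  have h2 := Submodule.finrank_mono h1
  rw [D.finrank_ortho] at h2
  omega

theorem exists_anisotropic {N : Submodule ℂ V} (hN : finrank ℂ N ≤ 4) :
    ∃ u ∈ D.b.orthogonal N, D.b u u ≠ 0 := by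
  by_contra! h
  have h1 := (D.isotropic_of_self h).finrank_le
  rw [D.finrank_ortho] at h1
  omega

/-- If `v ∉ N`, then `v` has a partner with respect to `b` that is orthogonal to `N`. -/
theorem exists_dual {N : Submodule ℂ V} {v : V} (hv : v ∉ N) :
    ∃ w ∈ D.b.orthogonal N, D.b v w = 1 := by
  have := D.finite_V
  by_contra! h
  have h0 : ∀ w ∈ D.b.orthogonal N, D.b v w = 0 := by
    intro w hw
    by_contra hne
    exact h ((D.b v w)⁻¹ • w) (Submodule.smul_mem _ _ hw) (by simp [hne])
  have h1 : D.b.orthogonal N ≤ D.b.orthogonal (N ⊔ ℂ ∙ v) := by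
    intro w hw
    refine D.mem_ortho.2 fun n hn => ?_
    obtain ⟨a, ha, c, hc, rfl⟩ := Submodule.mem_sup.1 hn
    obtain ⟨c, rfl⟩ := Submodule.mem_span_singleton.1 hc
    simp [D.mem_ortho.1 hw a ha, h0 w hw]
  have h2 := Submodule.finrank_mono h1
  have h3 : finrank ℂ N < finrank ℂ (N ⊔ ℂ ∙ v : Submodule ℂ V) := by
    refine Submodule.finrank_lt_finrank_of_lt (lt_of_le_of_ne le_sup_left fun h => hv ?_)
    rw [h]
    exact Submodule.mem_sup_right (Submodule.mem_span_singleton_self v)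
  have h4 := Submodule.finrank_le (N ⊔ ℂ ∙ v : Submodule ℂ V)
  rw [D.finrank_ortho, D.finrank_ortho] at h2
  rw [D.finrank_V] at h4
  omega

theorem zmod_two_cancel (i : ZMod 2) : i + 1 + 1 = i := by
  rw [add_assoc]; change i + 2 = i; have : (2 : ZMod 2) = 0 := rfl
  rw [this, add_zero]

theorem act_mem_killed {N : Submodule ℂ V} {i : ZMod 2} {u : V} (hu : u ∈ D.b.orthogonal N)
    {s : Δ} (hs : s ∈ D.killed N i) : D.act u s ∈ D.killed N (i + 1) := by
  rw [mem_killed] at hs ⊢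
  refine ⟨D.act_mem _ _ _ hs.1, fun v hv => ?_⟩
  rw [D.act_comm_of_ortho (D.mem_ortho.1 hu v hv), hs.2 v hv, map_zero, neg_zero]

theorem finrank_killed_le {N : Submodule ℂ V} (hN : finrank ℂ N ≤ 4) (i : ZMod 2) :
    finrank ℂ (D.killed N i) ≤ finrank ℂ (D.killed N (i + 1)) := by
  have := D.finite_Δ
  obtain ⟨u, hu, huu⟩ := D.exists_anisotropic hN
  have hinj : Function.Injective (D.act u) := by
    rw [← LinearMap.ker_eq_bot, LinearMap.ker_eq_bot']
    intro s hs
    have := D.act_act_self u s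
    rw [hs, map_zero] at this
    simpa [huu] using this.symm
  rw [(Submodule.equivMapOfInjective _ hinj (D.killed N i)).finrank_eq]
  refine Submodule.finrank_mono ?_
  rintro _ ⟨s, hs, rfl⟩
  exact D.act_mem_killed hu hs

theorem finrank_killed_eq {N : Submodule ℂ V} (hN : finrank ℂ N ≤ 4) (i : ZMod 2) :
    finrank ℂ (D.killed N i) = finrank ℂ (D.killed N (i + 1)) := by
  refine le_antisymm (D.finrank_killed_le hN i) ?_
  have := D.finrank_killed_le hN (i + 1)
  rwa [zmod_two_cancel] at this

theorem killed_bot (i : ZMod 2) : D.killed ⊥ i = D.par i := by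
  ext s; simp [mem_killed]

theorem finrank_par (i : ZMod 2) : finrank ℂ (D.par i) = 16 := by
  have := D.finite_Δ
  have h := Submodule.finrank_add_eq_of_isCompl D.isCompl
  rw [D.finrank_Δ] at h
  have h0 := D.finrank_killed_eq (N := ⊥) (by simp) 0
  rw [killed_bot, killed_bot, zero_add] at h0
  fin_cases i
  · change finrank ℂ (D.par 0) = 16; omega
  · change finrank ℂ (D.par 1) = 16; omega

theorem killed_sup_span {N : Submodule ℂ V} {v : V} {i : ZMod 2} {s : Δ} :
    s ∈ D.killed (N ⊔ ℂ ∙ v) i ↔ s ∈ D.killed N i ∧ D.act v s = 0 := by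
  simp only [mem_killed]
  constructor
  · exact fun h => ⟨⟨h.1, fun w hw => h.2 w (Submodule.mem_sup_left hw)⟩,
      h.2 v (Submodule.mem_sup_right (Submodule.mem_span_singleton_self v))⟩
  · rintro ⟨⟨h1, h2⟩, h3⟩
    refine ⟨h1, fun n hn => ?_⟩
    obtain ⟨a, ha, c, hc, rfl⟩ := Submodule.mem_sup.1 hn
    obtain ⟨c, rfl⟩ := Submodule.mem_span_singleton.1 hc
    simp [h2 a ha, h3]

theorem map_act_killed {N : Submodule ℂ V} {v : V} (hv : v ∉ N) (hi : D.Isotropic (N ⊔ ℂ ∙ v))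
    (i : ZMod 2) :
    (D.killed N i).map (D.act v) = D.killed (N ⊔ ℂ ∙ v) (i + 1) := by
  have hvm : v ∈ N ⊔ ℂ ∙ v := Submodule.mem_sup_right (Submodule.mem_span_singleton_self v)
  ext t
  rw [killed_sup_span]
  constructor
  · rintro ⟨s, hs, rfl⟩
    refine ⟨D.act_mem_killed (D.mem_ortho.2 fun n hn => hi _ (Submodule.mem_sup_left hn) _ hvm) hs, ?_⟩
    rw [D.act_act_self, hi v hvm v hvm]; simp
  · rintro ⟨ht, hvt⟩
    obtain ⟨w, hw, hvw⟩ := D.exists_dual hv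
    refine ⟨D.act w t, ?_, ?_⟩
    · have := D.act_mem_killed hw ht
      rwa [zmod_two_cancel] at this
    · have := D.rel v w t
      rw [hvt, map_zero, add_zero, hvw, one_smul] at this
      exact this

theorem finrank_killed_add {N : Submodule ℂ V} {v : V} (hv : v ∉ N)
    (hi : D.Isotropic (N ⊔ ℂ ∙ v)) (i : ZMod 2) :
    finrank ℂ (D.killed (N ⊔ ℂ ∙ v) (i + 1)) + finrank ℂ (D.killed (N ⊔ ℂ ∙ v) i) =
      finrank ℂ (D.killed N i) := by
  have := D.finite_Δ
  have h := LinearMap.finrank_range_add_finrank_ker ((D.act v).domRestrict (D.killed N i))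
  rw [LinearMap.range_domRestrict, D.map_act_killed hv hi] at h
  rw [← h]
  congr 1
  have : D.killed (N ⊔ ℂ ∙ v) i
      = (LinearMap.ker ((D.act v).domRestrict (D.killed N i))).map (D.killed N i).subtype := by
    ext s
    rw [killed_sup_span, and_comm]
    simp
  rw [this, Submodule.finrank_map_subtype_eq]

theorem finrank_killed {N : Submodule ℂ V} {k : ℕ} (hN : D.Isotropic N) (hk : finrank ℂ N = k)
    (hk4 : k ≤ 4) (i : ZMod 2) : finrank ℂ (D.killed N i) = 2 ^ (4 - k) := by
  have := D.finite_V
  induction k generalizing N i with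
  | zero =>
    rw [Submodule.finrank_eq_zero] at hk
    subst hk
    rw [killed_bot, finrank_par]; norm_num
  | succ k ih =>
    obtain ⟨N', hN', hk'⟩ := N.exists_le_finrank_eq (k := k) (by omega)
    obtain ⟨v, hv, hvN'⟩ : ∃ v ∈ N, v ∉ N' := by
      by_contra! h
      have := Submodule.finrank_mono (show N ≤ N' from h)
      omega
    have hle : N' ⊔ ℂ ∙ v ≤ N := sup_le hN' (by simpa using hv)
    have hlt : finrank ℂ N' < finrank ℂ (N' ⊔ ℂ ∙ v : Submodule ℂ V) := by
      refine Submodule.finrank_lt_finrank_of_lt (lt_of_le_of_ne le_sup_left fun h => hvN' ?_)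
      rw [h]
      exact Submodule.mem_sup_right (Submodule.mem_span_singleton_self v)
    obtain rfl : N' ⊔ ℂ ∙ v = N := Submodule.eq_of_le_of_finrank_le hle (by omega)
    have h1 := D.finrank_killed_add hvN' hN i
    rw [ih (hN.mono le_sup_left) hk' (by omega) i,
      ← D.finrank_killed_eq (by omega) i] at h1
    have h2 : 2 ^ (4 - k) = 2 ^ (4 - (k + 1)) * 2 := by
      rw [← pow_succ]; congr 1; omega
    omega

theorem le_finrank_ann {i : ZMod 2} {s : Δ} (hs : s ∈ D.par i) (hs0 : s ≠ 0)
    {N : Submodule ℂ V} {k : ℕ} (hN : N ≤ D.ann s) (hk : finrank ℂ N = k) (hk4 : k ≤ 4) :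
    10 - k ≤ finrank ℂ (D.ann s) + 2 ^ (4 - k) := by
  have := D.finite_V
  have := D.finite_Δ
  have hiso := (D.isotropic_ann hs0).mono hN
  have h := LinearMap.finrank_range_add_finrank_ker ((D.act.flip s).domRestrict (D.b.orthogonal N))
  have hsk : s ∈ D.killed N i := D.mem_killed.2 ⟨hs, fun v hv => D.mem_ann.1 (hN hv)⟩
  have h1 : LinearMap.range ((D.act.flip s).domRestrict (D.b.orthogonal N)) ≤ D.killed N (i + 1) := by
    rintro _ ⟨⟨m, hm⟩, rfl⟩
    exact D.act_mem_killed hm hsk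
  have h2 := Submodule.finrank_mono h1
  rw [D.finrank_killed hiso hk hk4] at h2
  have h3 : (LinearMap.ker ((D.act.flip s).domRestrict (D.b.orthogonal N))).map
      (D.b.orthogonal N).subtype ≤ D.ann s := by
    rintro _ ⟨⟨m, hm⟩, hm', rfl⟩
    exact hm'
  have h4 := Submodule.finrank_mono h3
  rw [Submodule.finrank_map_subtype_eq] at h4
  rw [D.finrank_ortho, hk] at h
  omega

/-- The annihilator of a nonzero half spinor cannot be of dimension `2`, `3` or `4`. -/
theorem finrank_ann_eq {i : ZMod 2} {s : Δ} (hs : s ∈ D.par i) (hs0 : s ≠ 0)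
    (h : 2 ≤ finrank ℂ (D.ann s)) : finrank ℂ (D.ann s) = 5 := by
  refine le_antisymm (D.isotropic_ann hs0).finrank_le ?_
  obtain ⟨N, hN, hk⟩ := (D.ann s).exists_le_finrank_eq h
  have h1 := D.le_finrank_ann hs hs0 hN hk (by norm_num)
  obtain ⟨N, hN, hk⟩ := (D.ann s).exists_le_finrank_eq (k := 4) (by omega)
  have h2 := D.le_finrank_ann hs hs0 hN hk (by norm_num)
  omega

/-- A maximal isotropic subspace does not annihilate nonzero half spinors of both parities. -/
theorem eq_zero_of_killed {W : Submodule ℂ V} (hW : D.Isotropic W) (h5 : finrank ℂ W = 5)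
    {i : ZMod 2} {s t : Δ} (hs : s ∈ D.killed W i) (ht : t ∈ D.killed W (i + 1)) (ht0 : t ≠ 0) :
    s = 0 := by
  have := D.finite_V
  have := D.finite_Δ
  obtain ⟨N, hN, hk⟩ := W.exists_le_finrank_eq (k := 4) (by omega)
  obtain ⟨u, hu, huN⟩ : ∃ v ∈ W, v ∉ N := by
    by_contra! h
    have := Submodule.finrank_mono (show W ≤ N from h)
    omega
  obtain ⟨w, hw, huw⟩ := D.exists_dual huN
  have hmono : ∀ j, D.killed W j ≤ D.killed N j := fun j x hx =>
    D.mem_killed.2 ⟨(D.mem_killed.1 hx).1, fun v hv => (D.mem_killed.1 hx).2 v (hN hv)⟩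
  have h1 : finrank ℂ (D.killed N (i + 1)) = 1 := by
    simpa using D.finrank_killed (hW.mono hN) hk le_rfl (i + 1)
  have hws := D.act_mem_killed hw (hmono _ hs)
  obtain ⟨c, hc⟩ := (finrank_eq_one_iff_of_nonzero' (⟨t, hmono _ ht⟩ : D.killed N (i + 1))
    (by simpa using ht0)).1 h1 ⟨_, hws⟩
  have hc' : c • t = D.act w s := congrArg Subtype.val hc
  have := D.rel u w s
  rw [(D.mem_killed.1 hs).2 u hu, ← hc', map_smul, (D.mem_killed.1 ht).2 u hu, huw] at this
  simpa using this.symm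

/-- Half spinors with maximal annihilators that meet in codimension `n` have parities that differ by
`n`. -/
theorem parity {n : ℕ} {i j : ZMod 2} {s t : Δ} (hs : s ∈ D.par i) (ht : t ∈ D.par j)
    (hs0 : s ≠ 0) (ht0 : t ≠ 0) (hs5 : finrank ℂ (D.ann s) = 5) (ht5 : finrank ℂ (D.ann t) = 5)
    (hn : finrank ℂ (D.ann s ⊓ D.ann t : Submodule ℂ V) + n = 5) : i = j + n := by
  have := D.finite_V
  have := D.finite_Δ
  induction n generalizing i s with
  | zero =>
    have h1 : D.ann s = D.ann t := by
      have h2 : D.ann s ⊓ D.ann t = D.ann s :=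
        Submodule.eq_of_le_of_finrank_le inf_le_left (by omega)
      have h3 : D.ann s ⊓ D.ann t = D.ann t :=
        Submodule.eq_of_le_of_finrank_le inf_le_right (by omega)
      rw [← h2, h3]
    by_contra hij
    have hj : j = i + 1 := by
      exact (by decide : ∀ i j : ZMod 2, ¬ i = j → j = i + 1) i j (by simpa using hij)
    subst hj
    refine hs0 (D.eq_zero_of_killed (D.isotropic_ann hs0) hs5
      (D.mem_killed.2 ⟨hs, fun v hv => D.mem_ann.1 hv⟩)
      (D.mem_killed.2 ⟨ht, fun v hv => D.mem_ann.1 (h1 ▸ hv)⟩) ht0)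
  | succ n ih =>
    obtain ⟨y, hyt, hys⟩ : ∃ y ∈ D.ann t, y ∉ D.ann s := by
      by_contra! h
      have : D.ann s ⊓ D.ann t = D.ann t := inf_eq_right.2 h
      rw [this] at hn
      omega
    have hiso := D.isotropic_ann ht0
    have hy0 : D.act y s ≠ 0 := fun h => hys (D.mem_ann.2 h)
    have hle : (D.ann s ⊓ D.ann t) ⊔ ℂ ∙ y ≤ D.ann (D.act y s) ⊓ D.ann t := by
      refine sup_le (fun x hx => ⟨?_, hx.2⟩) ?_
      · refine D.mem_ann.2 ?_
        rw [D.act_comm_of_ortho (hiso x hx.2 y hyt), D.mem_ann.1 hx.1, map_zero, neg_zero]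
      · rw [Submodule.span_singleton_le_iff_mem]
        refine ⟨D.mem_ann.2 ?_, hyt⟩
        rw [D.act_act_self, hiso y hyt y hyt]; simp
    -- the annihilator of `y · s` contains a hyperplane of the annihilator of `s`
    have hW : D.ann s ⊓ D.b.orthogonal (ℂ ∙ y) ≤ D.ann (D.act y s) := by
      rintro x ⟨hx, hxy⟩
      refine D.mem_ann.2 ?_
      rw [D.act_comm_of_ortho, D.mem_ann.1 hx, map_zero, neg_zero]
      rw [D.symm]
      exact D.mem_ortho.1 hxy y (Submodule.mem_span_singleton_self y)
    have hdim := Submodule.finrank_sup_add_finrank_inf_eq (D.ann s) (D.b.orthogonal (ℂ ∙ y))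
    have hyne : y ≠ 0 := fun h => hys (h ▸ zero_mem _)
    rw [D.finrank_ortho, finrank_span_singleton hyne] at hdim
    have hle10 := Submodule.finrank_le (D.ann s ⊔ D.b.orthogonal (ℂ ∙ y))
    rw [D.finrank_V] at hle10
    have h5 : finrank ℂ (D.ann (D.act y s)) = 5 := by
      refine D.finrank_ann_eq (D.act_mem _ _ _ hs) hy0 ?_
      have := Submodule.finrank_mono hW
      omega
    have hyW : y ∉ D.ann s ⊓ D.b.orthogonal (ℂ ∙ y) := fun h => hys h.1
    have hya : y ∈ D.ann (D.act y s) ⊓ D.ann t :=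
      hle (Submodule.mem_sup_right (Submodule.mem_span_singleton_self y))
    have heq : D.ann s ⊓ D.b.orthogonal (ℂ ∙ y) ⊔ ℂ ∙ y = D.ann (D.act y s) := by
      refine Submodule.eq_of_le_of_finrank_le (sup_le hW ?_) ?_
      · simpa using hya.1
      · rw [Submodule.finrank_sup_span_singleton hyW]
        omega
    have hge : D.ann (D.act y s) ⊓ D.ann t ≤ (D.ann s ⊓ D.ann t) ⊔ ℂ ∙ y := by
      rintro x ⟨hx, hxt⟩
      rw [← heq] at hx
      obtain ⟨a, ha, c, hc, rfl⟩ := Submodule.mem_sup.1 hx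
      obtain ⟨c, rfl⟩ := Submodule.mem_span_singleton.1 hc
      refine Submodule.add_mem_sup ⟨ha.1, ?_⟩ hc
      simpa using Submodule.sub_mem _ hxt (Submodule.smul_mem _ c hyt)
    have hfin : finrank ℂ (D.ann (D.act y s) ⊓ D.ann t : Submodule ℂ V) + n = 5 := by
      rw [le_antisymm hge hle, Submodule.finrank_sup_span_singleton (fun h : y ∈ D.ann s ⊓ D.ann t => hys h.1)]
      omega
    have := ih (D.act_mem _ _ _ hs) hy0 h5 hfin
    have h2 : i = (i + 1) + 1 := (zmod_two_cancel i).symm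
    rw [h2, this]
    push_cast
    ring

end SpinModule

theorem Module.End.exists_eigenvalue_ne_zero {X : Type*} [AddCommGroup X] [Module ℂ X]
    [FiniteDimensional ℂ X] {f : Module.End ℂ X} (hf : LinearMap.trace ℂ X f ≠ 0) :
    ∃ μ ≠ 0, f.HasEigenvalue μ := by
  by_contra! h
  refine hf ?_
  rw [Module.End.trace_eq_sum_roots_charpoly_of_splits (IsAlgClosed.splits _)]
  refine Multiset.sum_eq_zero fun μ hμ => ?_
  by_contra hne
  exact h μ hne ((Module.End.hasEigenvalue_iff_isRoot_charpoly f μ).2 (Polynomial.isRoot_of_mem_roots hμ))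

theorem Submodule.two_le_finrank {V : Type*} [AddCommGroup V] [Module ℂ V] [FiniteDimensional ℂ V]
    {N : Submodule ℂ V} {v m : V} (hv : v ≠ 0) (hvN : v ∈ N) (hm : m ∈ N) (hmv : m ∉ ℂ ∙ v) :
    2 ≤ finrank ℂ N := by
  have h : (ℂ ∙ v) ⊔ ℂ ∙ m ≤ N := sup_le (by simpa using hvN) (by simpa using hm)
  have := Submodule.finrank_mono h
  rwa [Submodule.finrank_sup_span_singleton hmv, finrank_span_singleton hv] at this

namespace SpinModule

variable {V Δ : Type*} [AddCommGroup V] [Module ℂ V] [AddCommGroup Δ] [Module ℂ Δ]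
  (D : SpinModule V Δ)

/-- Two nonzero half spinors of the same parity with maximal annihilators have a common
annihilating vector. -/
theorem exists_mem_ann_inf {i : ZMod 2} {s t : Δ} (hs : s ∈ D.par i) (ht : t ∈ D.par i)
    (hs0 : s ≠ 0) (ht0 : t ≠ 0) (hs5 : finrank ℂ (D.ann s) = 5) (ht5 : finrank ℂ (D.ann t) = 5) :
    ∃ v ≠ 0, v ∈ D.ann s ∧ v ∈ D.ann t := by
  by_contra! h
  have hbot : D.ann s ⊓ D.ann t = ⊥ := by
    rw [Submodule.eq_bot_iff]
    intro x hx
    by_contra hne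
    exact h x hne hx.1 hx.2
  have := D.parity (n := 5) hs ht hs0 ht0 hs5 ht5 (by rw [hbot, finrank_bot])
  revert this
  exact (by decide : ∀ i : ZMod 2, ¬ i = i + (5 : ℕ)) i

theorem isotropic_span_pair {v u : V} (hv : D.b v v = 0) (hu : D.b u u = 0) (hvu : D.b v u = 0) :
    D.Isotropic ((ℂ ∙ v) ⊔ ℂ ∙ u) := by
  refine D.isotropic_of_self fun x hx => ?_
  obtain ⟨a, ha, c, hc, rfl⟩ := Submodule.mem_sup.1 hx
  obtain ⟨a, rfl⟩ := Submodule.mem_span_singleton.1 ha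
  obtain ⟨c, rfl⟩ := Submodule.mem_span_singleton.1 hc
  simp [hv, hu, hvu, D.symm u v]

theorem finrank_killed_pair {v u : V} (hv0 : v ≠ 0) (huv : u ∉ ℂ ∙ v) (hv : D.b v v = 0)
    (hu : D.b u u = 0) (hvu : D.b v u = 0) (i : ZMod 2) :
    finrank ℂ (D.killed ((ℂ ∙ v) ⊔ ℂ ∙ u) i) = 4 := by
  have := D.finite_V
  rw [D.finrank_killed (D.isotropic_span_pair hv hu hvu) (k := 2) _ (by norm_num)]
  · norm_num
  · rw [Submodule.finrank_sup_span_singleton huv, finrank_span_singleton hv0]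

theorem mem_killed_span {v : V} {i : ZMod 2} {s : Δ} :
    s ∈ D.killed (ℂ ∙ v) i ↔ s ∈ D.par i ∧ D.act v s = 0 := by
  have := D.killed_sup_span (N := ⊥) (v := v) (i := i) (s := s)
  rwa [bot_sup_eq, killed_bot] at this

theorem mem_ortho_span {v m : V} : m ∈ D.b.orthogonal (ℂ ∙ v) ↔ D.b v m = 0 := by
  rw [mem_ortho]
  refine ⟨fun h => h v (Submodule.mem_span_singleton_self v), fun h n hn => ?_⟩
  obtain ⟨c, rfl⟩ := Submodule.mem_span_singleton.1 hn
  simp [h]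

/-- If the annihilator of `z` is the line spanned by `v`, then every spinor of opposite parity
killed by `v` is of the form `m · z` with `m` orthogonal to `v`. -/
theorem exists_section {i : ZMod 2} {v : V} {z : Δ} (hz : z ∈ D.par i) (hz0 : z ≠ 0)
    (hv0 : v ≠ 0) (hann : D.ann z = ℂ ∙ v) :
    ∃ σ : D.killed (ℂ ∙ v) (i + 1) →ₗ[ℂ] V, ∀ k, D.b v (σ k) = 0 ∧ D.act (σ k) z = k := by
  have := D.finite_V
  have := D.finite_Δ
  have hiso := D.isotropic_ann hz0
  have hzk : z ∈ D.killed (ℂ ∙ v) i :=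
    D.mem_killed.2 ⟨hz, fun w hw => D.mem_ann.1 (hann ▸ hw)⟩
  let g : D.b.orthogonal (ℂ ∙ v) →ₗ[ℂ] D.killed (ℂ ∙ v) (i + 1) :=
    (D.act.flip z).restrict fun m hm => D.act_mem_killed hm hzk
  have hker : (LinearMap.ker g).map (D.b.orthogonal (ℂ ∙ v)).subtype ≤ D.ann z := by
    rintro _ ⟨⟨m, hm⟩, hm', rfl⟩
    exact congrArg Subtype.val hm'
  have h1 := Submodule.finrank_mono hker
  rw [Submodule.finrank_map_subtype_eq, hann, finrank_span_singleton hv0] at h1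
  have h2 := g.finrank_range_add_finrank_ker
  rw [D.finrank_ortho, finrank_span_singleton hv0] at h2
  have h3 := D.finrank_killed (N := ℂ ∙ v) (hann ▸ hiso) (finrank_span_singleton hv0)
    (by norm_num) (i + 1)
  have hsurj : LinearMap.range g = ⊤ := by
    refine Submodule.eq_of_le_of_finrank_le le_top ?_
    rw [finrank_top]
    omega
  obtain ⟨σ, hσ⟩ := g.exists_rightInverse_of_surjective hsurj
  refine ⟨(D.b.orthogonal (ℂ ∙ v)).subtype ∘ₗ σ, fun k => ⟨D.mem_ortho_span.1 (σ k).2, ?_⟩⟩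
  exact congrArg Subtype.val (LinearMap.congr_fun hσ k)

/-- A linear family of endomorphisms `Ψ s`, given by `m · z ↦ m · s`, which detects the pure spinors
on the space of spinors killed by `v`. -/
theorem exists_pencil {v : V} {z : Δ} (hz : z ∈ D.par 0) (hz0 : z ≠ 0)
    (hv0 : v ≠ 0) (hann : D.ann z = ℂ ∙ v) :
    ∃ Ψ : Δ →ₗ[ℂ] Module.End ℂ (D.killed (ℂ ∙ v) 1),
      (∀ s ∈ D.killed (ℂ ∙ v) 0, s ≠ 0 →
        (LinearMap.det (Ψ s) = 0 ↔ 2 ≤ finrank ℂ (D.ann s))) ∧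
      (∀ s ∈ D.killed (ℂ ∙ v) 0, LinearMap.trace ℂ _ (Ψ s) ≠ 0 →
        ∃ μ : ℂ, μ ≠ 0 ∧ 2 ≤ finrank ℂ (D.ann (s - μ • z))) ∧
      (∀ u ∉ ℂ ∙ v, D.b u u = 0 → D.b v u = 0 →
        ∃ y ∈ D.killed ((ℂ ∙ v) ⊔ ℂ ∙ u) 0, LinearMap.trace ℂ _ (Ψ y) ≠ 0) := by
  have := D.finite_V
  have := D.finite_Δ
  have hiso := D.isotropic_ann hz0
  have hvann : v ∈ D.ann z := hann ▸ Submodule.mem_span_singleton_self v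
  have hvv : D.b v v = 0 := hiso v hvann v hvann
  have hzk : z ∈ D.killed (ℂ ∙ v) 0 := D.mem_killed_span.2 ⟨hz, D.mem_ann.1 hvann⟩
  obtain ⟨σ, hσ⟩ : ∃ σ : D.killed (ℂ ∙ v) 1 →ₗ[ℂ] V, ∀ k, D.b v (σ k) = 0 ∧ D.act (σ k) z = k :=
    D.exists_section hz hz0 hv0 hann
  have hσv : ∀ k, k ≠ 0 → σ k ∉ ℂ ∙ v := by
    intro k hk h
    exact hk (Subtype.ext ((hσ k).2.symm.trans (D.mem_ann.1 (hann.ge h))))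
  have hact : ∀ m, D.b v m = 0 → ∀ s ∈ D.killed (ℂ ∙ v) 0, D.act m s ∈ D.killed (ℂ ∙ v) 1 :=
    fun m hm s hs => D.act_mem_killed (i := 0) (D.mem_ortho_span.2 hm) hs
  have hact' : ∀ m, D.b v m = 0 → ∀ s ∈ D.killed (ℂ ∙ v) 1, D.act m s ∈ D.killed (ℂ ∙ v) 0 :=
    fun m hm s hs => D.act_mem_killed (i := 1) (D.mem_ortho_span.2 hm) hs
  obtain ⟨π, hπ⟩ := (D.killed (ℂ ∙ v) 1).subtype.exists_leftInverse_of_injective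
    (Submodule.ker_subtype _)
  have hπ' : ∀ k (hk : k ∈ D.killed (ℂ ∙ v) 1), π k = ⟨k, hk⟩ := fun k hk =>
    LinearMap.congr_fun hπ ⟨k, hk⟩
  let Ψ : Δ →ₗ[ℂ] Module.End ℂ (D.killed (ℂ ∙ v) 1) :=
    { toFun := fun s => π ∘ₗ D.act.flip s ∘ₗ σ
      map_add' := fun s t => by ext; simp
      map_smul' := fun c s => by ext; simp }
  have hΨ : ∀ s ∈ D.killed (ℂ ∙ v) 0, ∀ k, (Ψ s k : Δ) = D.act (σ k) s := fun s hs k => by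
    change ((π (D.act (σ k) s) : D.killed (ℂ ∙ v) 1) : Δ) = _
    rw [hπ' _ (hact _ (hσ k).1 s hs)]
  refine ⟨Ψ, fun s hs hs0 => ?_, fun s hs htr => ?_, fun u huv huu hvu => ?_⟩
  · have hsann : v ∈ D.ann s := D.mem_ann.2 (D.mem_killed_span.1 hs).2
    rw [← not_iff_not, ← ne_eq, ← isUnit_iff_ne_zero, ← LinearMap.isUnit_iff_isUnit_det,
      Module.End.isUnit_iff, not_le]
    constructor
    · intro hinj
      by_contra! hlt
      obtain ⟨m, hm, hmv⟩ : ∃ m ∈ D.ann s, m ∉ ℂ ∙ v := by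
        by_contra! h
        have := Submodule.finrank_mono (show D.ann s ≤ ℂ ∙ v from h)
        rw [finrank_span_singleton hv0] at this
        omega
      have hvm : D.b v m = 0 := D.isotropic_ann hs0 v hsann m hm
      have hmz := hact m hvm z hzk
      have h1 : σ ⟨_, hmz⟩ - m ∈ D.ann z := by
        rw [D.mem_ann, map_sub, LinearMap.sub_apply, (hσ _).2, sub_self]
      rw [hann] at h1
      obtain ⟨c, hc⟩ := Submodule.mem_span_singleton.1 h1
      have h2 : Ψ s ⟨_, hmz⟩ = 0 := by
        refine Subtype.ext ?_
        rw [hΨ s hs, ← sub_add_cancel (σ ⟨_, hmz⟩) m, ← hc]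
        refine D.mem_ann.1 (?_ : _ ∈ D.ann s)
        exact Submodule.add_mem _ (Submodule.smul_mem _ _ hsann) hm
      have h3 := hinj.1 (h2.trans (map_zero _).symm)
      refine hmv (hann ▸ D.mem_ann.2 (congrArg Subtype.val h3))
    · intro hlt
      have hinj : Function.Injective (Ψ s) := by
        rw [← LinearMap.ker_eq_bot, LinearMap.ker_eq_bot']
        intro k hk
        by_contra hk0
        have : σ k ∈ D.ann s := by
          rw [D.mem_ann, ← hΨ s hs, hk]; rfl
        have := Submodule.two_le_finrank hv0 hsann this (hσv k hk0)
        omega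
      exact ⟨hinj, LinearMap.injective_iff_surjective.1 hinj⟩
  · obtain ⟨μ, hμ, heig⟩ := Module.End.exists_eigenvalue_ne_zero htr
    obtain ⟨k, hk⟩ := heig.exists_hasEigenvector
    refine ⟨μ, hμ, Submodule.two_le_finrank hv0 ?_ ?_ (hσv k hk.2)⟩
    · rw [D.mem_ann, map_sub, map_smul, (D.mem_killed_span.1 hs).2, D.mem_ann.1 hvann]; simp
    · rw [D.mem_ann, map_sub, map_smul, (hσ k).2, ← hΨ s hs, hk.apply_eq_smul]; simp
  · obtain ⟨w, hw, huw⟩ := D.exists_dual huv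
    rw [D.mem_ortho_span] at hw
    have hwz := hact w hw z hzk
    have huz := hact u hvu z hzk
    have hy := hact' u hvu _ hwz
    let T : Module.End ℂ (D.killed (ℂ ∙ v) 1) :=
      (D.act u ∘ₗ D.act w).restrict fun k hk => hact u hvu _ (hact' w hw k hk)
    have hT : ∀ k, (T k : Δ) = D.act u (D.act w k) := fun k => rfl
    have hTid : IsIdempotentElem T := by
      refine LinearMap.ext fun k => Subtype.ext ?_
      change (T (T k) : Δ) = T k
      rw [hT, hT, eq_sub_of_add_eq' (D.rel u w _), map_sub, D.act_act_self u, huu, huw]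
      simp
    have hT0 : T ≠ 0 := by
      have h4 := D.finrank_killed_pair hv0 huv hvv huu hvu 1
      obtain ⟨k, hk, hk0⟩ := (Submodule.ne_bot_iff _).1
        (show D.killed ((ℂ ∙ v) ⊔ ℂ ∙ u) 1 ≠ ⊥ by rintro h; rw [h, finrank_bot] at h4; omega)
      obtain ⟨hk1, hk2⟩ := D.killed_sup_span.1 hk
      intro h
      have h5 := hT ⟨k, hk1⟩
      rw [h] at h5
      have h6 := D.rel u w k
      rw [hk2, map_zero, add_zero, huw, one_smul, ← h5] at h6
      exact hk0 h6.symm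
    refine ⟨D.act u (D.act w z), D.killed_sup_span.2 ⟨hy, by rw [D.act_act_self, huu]; simp⟩, ?_⟩
    have hsec : ∀ m (hm : D.b v m = 0) (hmz : D.act m z ∈ D.killed (ℂ ∙ v) 1) (x : V),
        D.b v x = 0 → D.b (σ ⟨_, hmz⟩) x = D.b m x := by
      intro m hm hmz x hx
      have h1 : σ ⟨_, hmz⟩ - m ∈ D.ann z := by
        rw [D.mem_ann, map_sub, LinearMap.sub_apply, (hσ _).2, sub_self]
      rw [hann] at h1
      obtain ⟨c, hc⟩ := Submodule.mem_span_singleton.1 h1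
      rw [← sub_add_cancel (σ ⟨_, hmz⟩) m, ← hc]
      simp [hx]
    have hdecomp : Ψ (D.act u (D.act w z)) =
        (D.b.flip u ∘ₗ σ).smulRight ⟨_, hwz⟩ - (D.b.flip w ∘ₗ σ).smulRight ⟨_, huz⟩ + T := by
      refine LinearMap.ext fun k => Subtype.ext ?_
      rw [hΨ _ hy]
      have e1 := eq_sub_of_add_eq (D.rel (σ k) u (D.act w z))
      have e2 := eq_sub_of_add_eq (D.rel (σ k) w z)
      rw [(hσ k).2] at e2
      rw [e1, e2, map_sub, map_smul]
      change _ = D.b (σ k) u • D.act w z - D.b (σ k) w • D.act u z + D.act u (D.act w k)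
      abel
    rw [hdecomp, map_add, map_sub, LinearMap.trace_smulRight, LinearMap.trace_smulRight]
    have e1 : (D.b.flip u ∘ₗ σ) ⟨_, hwz⟩ = 1 := by
      change D.b (σ _) u = 1
      rw [hsec w hw hwz u hvu, D.symm, huw]
    have e2 : (D.b.flip w ∘ₗ σ) ⟨_, huz⟩ = 1 := by
      change D.b (σ _) w = 1
      rw [hsec u hvu huz w hw, huw]
    rw [e1, e2, sub_self, zero_add]
    exact fun h => hT0 ((LinearMap.IsIdempotentElem.trace_eq_zero_iff hTid).1 h)

end SpinModule

section ProjectiveLemmas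

variable {M : Type*} [AddCommGroup M] [Module ℂ M]

theorem evalAt_X (φ : Module.Dual ℂ M) (x : M) : evalAt (MvPolynomial.X φ) x = φ x := by
  simp [evalAt]

theorem exists_evalAt_eq_det {X : Type*} [AddCommGroup X] [Module ℂ X] [FiniteDimensional ℂ X]
    (L : M →ₗ[ℂ] Module.End ℂ X) :
    ∃ F : MvPolynomial (Module.Dual ℂ M) ℂ, F.IsHomogeneous (finrank ℂ X) ∧
      ∀ x, evalAt F x = LinearMap.det (L x) := by
  let B := finBasis ℂ X
  let A : Matrix (Fin (finrank ℂ X)) (Fin (finrank ℂ X)) (MvPolynomial (Module.Dual ℂ M) ℂ) :=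
    Matrix.of fun i j => MvPolynomial.X (B.coord i ∘ₗ L.flip (B j))
  refine ⟨A.det, ?_, fun x => ?_⟩
  · rw [Matrix.det_apply]
    refine MvPolynomial.IsHomogeneous.sum _ _ _ fun σ _ => ?_
    rw [Units.smul_def, zsmul_eq_mul, ← map_intCast (MvPolynomial.C (R := ℂ) (σ := Module.Dual ℂ M))]
    refine MvPolynomial.IsHomogeneous.C_mul ?_ _
    have := MvPolynomial.IsHomogeneous.prod Finset.univ (fun i => A (σ i) i) (fun _ => 1)
      fun i _ => MvPolynomial.isHomogeneous_X _ _
    simpa using this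
  · rw [← LinearMap.det_toMatrix B]
    unfold evalAt
    rw [RingHom.map_det]
    congr 1
    ext i j
    simp [A, LinearMap.toMatrix_apply]

theorem evalAt_eq_zero_of_line {F : MvPolynomial (Module.Dual ℂ M) ℂ} {x y : M} {s : Set ℂ}
    (hs : s.Finite) (h : ∀ ε ∉ s, evalAt F (x + ε • y) = 0) : evalAt F x = 0 := by
  let P : Polynomial ℂ := MvPolynomial.eval₂ Polynomial.C
    (fun φ : Module.Dual ℂ M => Polynomial.C (φ x) + Polynomial.X * Polynomial.C (φ y)) F
  have hP : ∀ ε, P.eval ε = evalAt F (x + ε • y) := by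
    intro ε
    have := MvPolynomial.hom_eval₂ F Polynomial.C (Polynomial.evalRingHom ε)
      (fun φ : Module.Dual ℂ M => Polynomial.C (φ x) + Polynomial.X * Polynomial.C (φ y))
    rw [Polynomial.coe_evalRingHom] at this
    rw [this]
    unfold evalAt
    rw [MvPolynomial.eval, MvPolynomial.coe_eval₂Hom]
    congr 1
    · ext; simp
    · ext φ; simp only [Polynomial.eval_add, Polynomial.eval_mul, Polynomial.eval_C,
        Polynomial.eval_X, map_add, map_smul, smul_eq_mul]
  have hP0 : P = 0 := by
    refine Polynomial.eq_zero_of_infinite_isRoot P ((hs.infinite_compl).mono fun ε hε => ?_)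
    exact (hP ε).trans (h ε hε)
  have := hP 0
  rw [hP0] at this
  simpa using this.symm

theorem evalAt_mk_rep {F : MvPolynomial (Module.Dual ℂ M) ℂ} {n : ℕ} (hF : F.IsHomogeneous n)
    {x : M} (hx : x ≠ 0) (h : evalAt F (Projectivization.mk ℂ x hx).rep = 0) : evalAt F x = 0 := by
  obtain ⟨a, ha⟩ := Projectivization.exists_smul_eq_mk_rep ℂ x hx
  rw [← ha, Units.smul_def, evalAt_smul hF] at h
  exact (mul_eq_zero.1 h).resolve_left (pow_ne_zero _ a.ne_zero)

theorem mem_lineThrough_iff {x y z : Projectivization ℂ M} :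
    z ∈ lineThrough x y ↔ ∃ a c : ℂ, a • x.rep + c • y.rep = z.rep := by
  change z.submodule ≤ _ ↔ _
  rw [z.submodule_eq, x.submodule_eq, y.submodule_eq, Submodule.span_singleton_le_iff_mem,
    ← Submodule.span_insert, Submodule.mem_span_pair]

end ProjectiveLemmas

namespace SpinModule

variable {V Δ : Type*} [AddCommGroup V] [Module ℂ V] [AddCommGroup Δ] [Module ℂ Δ]
  (D : SpinModule V Δ)

theorem ann_smul {c : ℂ} (hc : c ≠ 0) (s : Δ) : D.ann (c • s) = D.ann s := by
  ext v; simp [mem_ann, hc]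

/-- The classes of the pure spinors of even parity. -/
def pureSpinors : Set (Projectivization ℂ (D.par 0)) :=
  {p | 2 ≤ finrank ℂ (D.ann (p.rep : Δ))}

theorem mk_mem_pureSpinors {s : D.par 0} (hs : s ≠ 0) :
    Projectivization.mk ℂ s hs ∈ D.pureSpinors ↔ 2 ≤ finrank ℂ (D.ann (s : Δ)) := by
  obtain ⟨a, ha⟩ := Projectivization.exists_smul_eq_mk_rep ℂ s hs
  change 2 ≤ finrank ℂ (D.ann ((Projectivization.mk ℂ s hs).rep : Δ)) ↔ _
  rw [← ha, Units.smul_def, Submodule.coe_smul, D.ann_smul a.ne_zero]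

theorem rep_ne_zero (p : Projectivization ℂ (D.par 0)) : (p.rep : Δ) ≠ 0 := fun h =>
  p.rep_nonzero (Subtype.ext h)

theorem exists_common_ann {x y z : Projectivization ℂ (D.par 0)} (hx : x ∈ D.pureSpinors)
    (hy : y ∈ D.pureSpinors) (hz : z ∈ lineThrough x y) :
    ∃ v ≠ 0, v ∈ D.ann (x.rep : Δ) ∧ v ∈ D.ann (y.rep : Δ) ∧ v ∈ D.ann (z.rep : Δ) := by
  obtain ⟨v, hv0, hvx, hvy⟩ := D.exists_mem_ann_inf x.rep.2 y.rep.2 (D.rep_ne_zero x)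
    (D.rep_ne_zero y) (D.finrank_ann_eq x.rep.2 (D.rep_ne_zero x) hx)
    (D.finrank_ann_eq y.rep.2 (D.rep_ne_zero y) hy)
  obtain ⟨a, c, h⟩ := mem_lineThrough_iff.1 hz
  refine ⟨v, hv0, hvx, hvy, ?_⟩
  rw [← h, D.mem_ann, Submodule.coe_add, Submodule.coe_smul, Submodule.coe_smul, map_add, map_smul,
    map_smul, D.mem_ann.1 hvx, D.mem_ann.1 hvy]
  simp

theorem ann_ne_bot {z : Projectivization ℂ (D.par 0)} (hz : z ∈ secantVariety D.pureSpinors) :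
    D.ann (z.rep : Δ) ≠ ⊥ := by
  have := D.finite_V
  intro hbot
  obtain ⟨π, hπ⟩ := (D.act.flip (z.rep : Δ)).exists_leftInverse_of_injective hbot
  let L : D.par 0 →ₗ[ℂ] Module.End ℂ V :=
    { toFun := fun s => π ∘ₗ D.act.flip (s : Δ)
      map_add' := fun s t => by ext; simp
      map_smul' := fun c s => by ext; simp }
  obtain ⟨F, hF, hFL⟩ := exists_evalAt_eq_det L
  have h := hz _ F hF ?_
  · rw [hFL, show L z.rep = LinearMap.id from hπ, LinearMap.det_id] at h
    exact one_ne_zero h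
  · rintro a ⟨x, hx, y, hy, -, ha⟩
    obtain ⟨v, hv0, -, -, hva⟩ := D.exists_common_ann hx hy ha
    rw [hFL]
    by_contra hdet
    rw [← ne_eq, ← isUnit_iff_ne_zero, ← LinearMap.isUnit_iff_isUnit_det, Module.End.isUnit_iff] at hdet
    refine hv0 (hdet.1 (?_ : L a.rep v = L a.rep 0))
    change π (D.act v a.rep) = _
    rw [D.mem_ann.1 hva, map_zero, map_zero]

/-- The entry locus of the pure spinors with respect to `z` consists of the pure spinors that are
killed by the vector `v` that kills `z`. -/
theorem entryLocus_eq {z : Projectivization ℂ (D.par 0)} (hz : z ∉ D.pureSpinors) {v : V}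
    (hv0 : v ≠ 0) (hann : D.ann (z.rep : Δ) = ℂ ∙ v) :
    entryLocus D.pureSpinors z = {p | p ∈ D.pureSpinors ∧ D.act v p.rep = 0} := by
  have := D.finite_V
  have := D.finite_Δ
  obtain ⟨Ψ, hdet, htr, hy⟩ := D.exists_pencil z.rep.2 (D.rep_ne_zero z) hv0 hann
  ext p
  constructor
  · intro hp
    have hT : ∀ x ∈ {x | x ∈ D.pureSpinors ∧ ∃ y ∈ D.pureSpinors, y ≠ x ∧ z ∈ lineThrough x y},
        D.act v x.rep = 0 := by
      rintro x ⟨hx, y, hy, -, hxy⟩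
      obtain ⟨w, hw0, hwx, -, hwz⟩ := D.exists_common_ann hx hy hxy
      rw [hann] at hwz
      obtain ⟨c, rfl⟩ := Submodule.mem_span_singleton.1 hwz
      have hc : c ≠ 0 := by rintro rfl; simp at hw0
      have := D.mem_ann.1 hwx
      rw [map_smul, LinearMap.smul_apply] at this
      exact (smul_eq_zero.1 this).resolve_left hc
    have hvp : D.act v p.rep = 0 := by
      rw [← Module.forall_dual_apply_eq_zero_iff ℂ]
      intro φ
      have := hp 1 (MvPolynomial.X (φ ∘ₗ D.act v ∘ₗ (D.par 0).subtype))
        (MvPolynomial.isHomogeneous_X _ _) fun a ha => by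
          rw [evalAt_X]
          change φ (D.act v a.rep) = 0
          rw [hT a ha, map_zero]
      rwa [evalAt_X] at this
    refine ⟨?_, hvp⟩
    obtain ⟨F, hF, hFL⟩ := exists_evalAt_eq_det (Ψ ∘ₗ (D.par 0).subtype)
    have h := hp _ F hF fun a ha => by
      rw [hFL]
      exact (hdet _ (D.mem_killed_span.2 ⟨a.rep.2, hT a ha⟩) (D.rep_ne_zero a)).2 ha.1
    rw [hFL] at h
    exact (hdet _ (D.mem_killed_span.2 ⟨p.rep.2, hvp⟩) (D.rep_ne_zero p)).1 h
  · rintro ⟨hp, hvp⟩ n F hF hT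
    have hiso := D.isotropic_ann (D.rep_ne_zero p)
    obtain ⟨u, hu, huv⟩ : ∃ u ∈ D.ann (p.rep : Δ), u ∉ ℂ ∙ v := by
      by_contra! h
      have h1 := Submodule.finrank_mono (show D.ann (p.rep : Δ) ≤ ℂ ∙ v from h)
      rw [finrank_span_singleton hv0] at h1
      have h2 : 2 ≤ finrank ℂ (D.ann (p.rep : Δ)) := hp
      omega
    obtain ⟨y, hyk, hytr⟩ := hy u huv (hiso u hu u hu) (hiso v (D.mem_ann.2 hvp) u hu)
    have hy0 : y ∈ D.par 0 := (D.mem_killed.1 hyk).1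
    have hpk : (p.rep : Δ) ∈ D.killed ((ℂ ∙ v) ⊔ ℂ ∙ u) 0 :=
      D.killed_sup_span.2 ⟨D.mem_killed_span.2 ⟨p.rep.2, hvp⟩, D.mem_ann.1 hu⟩
    let τ := LinearMap.trace ℂ _ ∘ₗ Ψ
    refine evalAt_eq_zero_of_line (y := ⟨y, hy0⟩) (Set.finite_singleton (-τ p.rep / τ y))
      fun ε hε => ?_
    have hτ : τ (p.rep + ε • y) ≠ 0 := by
      intro h
      refine hε ?_
      rw [map_add, map_smul, smul_eq_mul] at h
      rw [Set.mem_singleton_iff, eq_div_iff (show τ y ≠ 0 from hytr)]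
      linear_combination h
    set q : D.par 0 := p.rep + ε • ⟨y, hy0⟩ with hq
    have hqk : (q : Δ) ∈ D.killed ((ℂ ∙ v) ⊔ ℂ ∙ u) 0 :=
      Submodule.add_mem _ hpk (Submodule.smul_mem _ _ hyk)
    have hτq : τ q ≠ 0 := hτ
    have hq0 : q ≠ 0 := by
      intro h
      rw [h] at hτq
      exact hτq (map_zero τ)
    obtain ⟨hqk1, hqu⟩ := D.killed_sup_span.1 hqk
    have hqv := (D.mem_killed_span.1 hqk1).2
    have hqpure : 2 ≤ finrank ℂ (D.ann (q : Δ)) :=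
      Submodule.two_le_finrank hv0 (D.mem_ann.2 hqv) (D.mem_ann.2 hqu) huv
    obtain ⟨μ, hμ, hpure⟩ := htr q hqk1 hτq
    have hnot : ∀ c : ℂ, c ≠ 0 → (q : Δ) ≠ c • (z.rep : Δ) := by
      intro c hc h
      rw [h, D.ann_smul hc] at hqpure
      exact hz hqpure
    have hr0 : q - μ • z.rep ≠ 0 := by
      intro h
      exact hnot μ hμ (congrArg Subtype.val (sub_eq_zero.1 h))
    refine evalAt_mk_rep hF hq0 (hT _ ⟨(D.mk_mem_pureSpinors hq0).2 hqpure,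
      Projectivization.mk ℂ _ hr0, (D.mk_mem_pureSpinors hr0).2 hpure, ?_, ?_⟩)
    · rw [Ne, Projectivization.mk_eq_mk_iff']
      rintro ⟨c, hc⟩
      have h1 : (c - 1) • q = -(μ • z.rep) := by rw [sub_smul, hc, one_smul]; abel
      have hc1 : c - 1 ≠ 0 := by
        intro h0
        rw [h0, zero_smul, eq_comm, neg_eq_zero, smul_eq_zero] at h1
        exact h1.elim hμ z.rep_nonzero
      refine hnot ((c - 1)⁻¹ * -μ) (mul_ne_zero (inv_ne_zero hc1) (neg_ne_zero.2 hμ)) ?_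
      rw [← Submodule.coe_smul]
      refine congrArg Subtype.val ?_
      rw [mul_smul, neg_smul, ← h1, smul_smul, inv_mul_cancel₀ hc1, one_smul]
    · change z.submodule ≤ _
      rw [z.submodule_eq, Projectivization.submodule_mk, Projectivization.submodule_mk,
        Submodule.span_singleton_le_iff_mem, ← Submodule.span_insert, Submodule.mem_span_pair]
      refine ⟨μ⁻¹, -μ⁻¹, ?_⟩
      rw [smul_sub, smul_smul, neg_mul, inv_mul_cancel₀ hμ]
      module

theorem exists_entryLocus_eq {A : Set (Projectivization ℂ (D.par 0))}
    (hA : IsEntryLocus D.pureSpinors A) :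
    ∃ v ≠ 0, D.b v v = 0 ∧ A = {p | p ∈ D.pureSpinors ∧ D.act v p.rep = 0} := by
  have := D.finite_V
  obtain ⟨z, ⟨hzs, hz⟩, rfl⟩ := hA
  obtain ⟨v, hv, hv0⟩ := (Submodule.ne_bot_iff _).1 (D.ann_ne_bot hzs)
  have hann : D.ann (z.rep : Δ) = ℂ ∙ v := by
    refine le_antisymm (fun m hm => ?_) (by simpa using hv)
    by_contra h
    exact hz (Submodule.two_le_finrank hv0 hv hm h)
  exact ⟨v, hv0, D.isotropic_ann (D.rep_ne_zero z) v hv v hv, D.entryLocus_eq hz hv0 hann⟩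

theorem inter_entryLocus {A B : Set (Projectivization ℂ (D.par 0))}
    (hA : IsEntryLocus D.pureSpinors A) (hB : IsEntryLocus D.pureSpinors B) (hAB : A ≠ B) :
    A ∩ B = ∅ ∨ IsLinearSubspace 3 (A ∩ B) := by
  have := D.finite_V
  obtain ⟨v, hv0, hvv, rfl⟩ := D.exists_entryLocus_eq hA
  obtain ⟨w, hw0, hww, rfl⟩ := D.exists_entryLocus_eq hB
  have hwv : w ∉ ℂ ∙ v := by
    intro h
    obtain ⟨c, rfl⟩ := Submodule.mem_span_singleton.1 h
    have hc : c ≠ 0 := by rintro rfl; simp at hw0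
    refine hAB ?_
    ext p
    simp [hc]
  by_cases hvw : D.b v w = 0
  · right
    refine ⟨(D.killed ((ℂ ∙ v) ⊔ ℂ ∙ w) 0).comap (D.par 0).subtype, ?_, ?_⟩
    · rw [← Submodule.finrank_map_subtype_eq, Submodule.map_comap_subtype,
        inf_eq_right.2 (fun s hs => (D.mem_killed.1 hs).1),
        D.finrank_killed_pair hv0 hwv hvv hww hvw]
    · ext p
      rw [Set.mem_ofPred_eq, p.submodule_eq, Submodule.span_singleton_le_iff_mem,
        Submodule.mem_comap, killed_sup_span, mem_killed_span]
      constructor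
      · rintro ⟨⟨-, h1⟩, -, h2⟩
        exact ⟨⟨p.rep.2, h1⟩, h2⟩
      · rintro ⟨⟨-, h1⟩, h2⟩
        have hp : p ∈ D.pureSpinors :=
          Submodule.two_le_finrank hv0 (D.mem_ann.2 h1) (D.mem_ann.2 h2) hwv
        exact ⟨⟨hp, h1⟩, hp, h2⟩
  · left
    rw [Set.eq_empty_iff_forall_notMem]
    rintro p ⟨⟨-, h1⟩, -, h2⟩
    exact hvw (D.isotropic_ann (D.rep_ne_zero p) v (D.mem_ann.2 h1) w (D.mem_ann.2 h2))

end SpinModule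

section Spinor

variable (E : Type*) [AddCommGroup E] [Module ℂ E]

theorem contractLeft_mem_evenOdd (f : Module.Dual ℂ E) (i : ZMod 2) (s : ExteriorAlgebra ℂ E)
    (hs : s ∈ CliffordAlgebra.evenOdd (0 : QuadraticForm ℂ E) i) :
    CliffordAlgebra.contractLeft f s ∈ CliffordAlgebra.evenOdd (0 : QuadraticForm ℂ E) (i + 1) := by
  have hι : ∀ (e : E) (j : ZMod 2), ∀ x ∈ CliffordAlgebra.evenOdd (0 : QuadraticForm ℂ E) j,
      CliffordAlgebra.ι 0 e * x ∈ CliffordAlgebra.evenOdd (0 : QuadraticForm ℂ E) (j + 1) := by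
    intro e j x hx
    rw [add_comm]
    exact SetLike.mul_mem_graded (CliffordAlgebra.ι_mem_evenOdd_one _ e) hx
  have hstep : ∀ (j : ZMod 2) (a c : E), ∀ x ∈ CliffordAlgebra.evenOdd (0 : QuadraticForm ℂ E) j,
      CliffordAlgebra.contractLeft f x ∈ CliffordAlgebra.evenOdd (0 : QuadraticForm ℂ E) (j + 1) →
      CliffordAlgebra.contractLeft f (CliffordAlgebra.ι 0 a * CliffordAlgebra.ι 0 c * x) ∈
        CliffordAlgebra.evenOdd (0 : QuadraticForm ℂ E) (j + 1) := by
    intro j a c x hx hfx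
    rw [mul_assoc, CliffordAlgebra.contractLeft_ι_mul, CliffordAlgebra.contractLeft_ι_mul]
    refine Submodule.sub_mem _ (Submodule.smul_mem _ _ (hι _ _ _ hx)) (hι _ _ _ ?_)
    refine Submodule.sub_mem _ (Submodule.smul_mem _ _ hx) ?_
    have := hι c _ _ hfx
    rwa [SpinModule.zmod_two_cancel] at this
  obtain rfl | rfl : i = 0 ∨ i = 1 := (by decide : ∀ i : ZMod 2, i = 0 ∨ i = 1) i
  · induction s, hs using CliffordAlgebra.even_induction with
    | algebraMap r =>
      rw [CliffordAlgebra.contractLeft_algebraMap]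
      exact zero_mem _
    | add x y hx hy ihx ihy => rw [map_add]; exact Submodule.add_mem _ ihx ihy
    | ι_mul_ι_mul a c x hx ih => exact hstep _ _ _ _ hx ih
  · induction s, hs using CliffordAlgebra.odd_induction with
    | ι e =>
      rw [CliffordAlgebra.contractLeft_ι]
      rw [Algebra.algebraMap_eq_smul_one]
      exact Submodule.smul_mem _ _ (CliffordAlgebra.one_le_evenOdd_zero _ (Submodule.one_le.1 le_rfl))
    | add x y hx hy ihx ihy => rw [map_add]; exact Submodule.add_mem _ ihx ihy
    | ι_mul_ι_mul a c x hx ih => exact hstep _ _ _ _ hx ih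

theorem cliffordAction_mem_evenOdd (i : ZMod 2) (v : Module.Dual ℂ E × E)
    (s : ExteriorAlgebra ℂ E) (hs : s ∈ CliffordAlgebra.evenOdd (0 : QuadraticForm ℂ E) i) :
    cliffordAction E v s ∈ CliffordAlgebra.evenOdd (0 : QuadraticForm ℂ E) (i + 1) := by
  rw [cliffordAction_apply]
  refine Submodule.add_mem _ (contractLeft_mem_evenOdd E _ _ _ hs) ?_
  rw [add_comm i]
  exact SetLike.mul_mem_graded (CliffordAlgebra.ι_mem_evenOdd_one _ _) hs

variable {E}

theorem cliffordAction_anticomm (u w : Module.Dual ℂ E × E) (s : ExteriorAlgebra ℂ E) :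
    cliffordAction E u (cliffordAction E w s) + cliffordAction E w (cliffordAction E u s) =
      LinearMap.dualProd ℂ E u w • s := by
  have h := cliffordAction_sq E (u + w) s
  have hQ : QuadraticForm.dualProd ℂ E (u + w) = QuadraticForm.dualProd ℂ E u +
      QuadraticForm.dualProd ℂ E w + LinearMap.dualProd ℂ E u w := by
    simp only [QuadraticForm.dualProd_apply, LinearMap.dualProd_apply_apply, Prod.fst_add,
      Prod.snd_add, LinearMap.add_apply, map_add]
    ring
  rw [hQ, add_smul, add_smul, ← cliffordAction_sq, ← cliffordAction_sq] at h
  simp only [map_add, LinearMap.add_apply] at h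
  rw [← add_right_inj (cliffordAction E u (cliffordAction E u s) +
    cliffordAction E w (cliffordAction E w s)), ← h]
  abel

/-- The spin module `⋀ E` of a `5`-dimensional space `E`. -/
def spinModule (hE : finrank ℂ E = 5) :
    SpinModule (Module.Dual ℂ E × E) (ExteriorAlgebra ℂ E) where
  b := LinearMap.dualProd ℂ E
  act := cliffordAction E
  par := CliffordAlgebra.evenOdd (0 : QuadraticForm ℂ E)
  symm u w := (LinearMap.isSymm_dualProd ℂ E).eq u w
  nondeg := by
    have : FiniteDimensional ℂ E := FiniteDimensional.of_finrank_pos (by omega)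
    refine (LinearMap.IsRefl.nondegenerate_iff_separatingLeft
      (LinearMap.isSymm_dualProd ℂ E).isRefl).2 ?_
    exact (LinearMap.separatingLeft_dualProd ℂ E).2 (Module.eval_apply_injective ℂ)
  rel := cliffordAction_anticomm
  act_mem := fun i v s hs => cliffordAction_mem_evenOdd E i v s hs
  isCompl := CliffordAlgebra.evenOdd_isCompl _
  finrank_V := by
    have : FiniteDimensional ℂ E := FiniteDimensional.of_finrank_pos (by omega)
    rw [finrank_prod, Subspace.dual_finrank_eq, hE]
  finrank_Δ := by
    have : FiniteDimensional ℂ E := FiniteDimensional.of_finrank_pos (by omega)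
    rw [finrank_eq_card_basis (finBasis ℂ E).ExteriorAlgebra, Fintype.card_finset, Fintype.card_fin,
      hE]
    norm_num

theorem spinorVariety_eq (hE : finrank ℂ E = 5) :
    spinorVariety E = (spinModule hE).pureSpinors := by
  set D := spinModule hE with hD
  have hV := D.finite_V
  have hQ : ∀ v, D.b v v = 2 * QuadraticForm.dualProd ℂ E v := fun v => by
    change LinearMap.dualProd ℂ E v v = _
    rw [LinearMap.dualProd_apply_apply, QuadraticForm.dualProd_apply, two_mul]
  ext p
  constructor
  · rintro ⟨W, ⟨hW, -⟩, hWp⟩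
    have h : W ≤ D.ann (p.rep : ExteriorAlgebra ℂ E) := fun w hw => D.mem_ann.2 (hWp w hw)
    have := Submodule.finrank_mono h
    change 2 ≤ finrank ℂ (D.ann (p.rep : ExteriorAlgebra ℂ E))
    omega
  · intro hp
    have h5 := D.finrank_ann_eq (p.rep).2 (D.rep_ne_zero p) hp
    refine ⟨D.ann (p.rep : ExteriorAlgebra ℂ E), ⟨h5.trans hE.symm, fun w hw => ?_⟩,
      fun w hw => D.mem_ann.1 hw⟩
    have := D.isotropic_ann (D.rep_ne_zero p) w hw w hw
    rw [hQ] at this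
    simpa using this

end Spinor

theorem proposition5p12 {E : Type*} [AddCommGroup E] [Module ℂ E]
    (hE : Module.finrank ℂ E = 5)
    (A B : Set (Projectivization ℂ (halfSpin E)))
    (hA : IsEntryLocus (spinorVariety E) A) (hB : IsEntryLocus (spinorVariety E) B)
    (hAB : A ≠ B) :
    A ∩ B = ∅ ∨ IsLinearSubspace 3 (A ∩ B) := by
  rw [spinorVariety_eq hE] at hA hB
  exact (spinModule hE).inter_entryLocus hA hB hAB
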